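/- **Theorem 4.1.** Let $\psi:\mathbb R\to\mathbb C$ be a continuous potential and consider the Dirac problem $$f'(x)=V(x,\lambda)f(x),\qquad V(x,\lambda)=\begin{pmatrix}-\tfrac{i\lambda}{2}&\overline{\psi}(x)\\ \psi(x)&\tfrac{i\lambda}{2}\end{pmatrix},\qquad f:\mathbb R\to\mathbb C^2 .$$ Let $\Gamma=\Gamma_+\cup\Gamma_-$ be two copies of $\mathbb C\setminus\mathbb R$; a point $Q\in\Gamma$ is a pair $(\lambda(Q),\pm)$. Put $$\Gamma_R=\{Q\in\Gamma_+:\Im\lambda(Q)>0\}\cup\{Q\in\Gamma_-:\Im\lambda(Q)<0\},\qquad \Gamma_L=\Gamma\setminus\Gamma_R .$$ Fix $y\in\mathbb R$. A Weyl solution at $Q$ is a solution $f$ with $\lambda=\lambda(Q)$ such that $|f_1|^2+|f_2|^2$ is integrable on $[y,\infty)$ if $Q\in\Gamma_R$, and on $(-\infty,y]$ if $Q\in\Gamma_L$. The Weyl function $\mathcal X(Q)=\mathcal X(y,Q)$ is the number for which the solution with value $(1,\mathcal X(Q))$ at $x=y$ is a Weyl solution at $Q$; if a nontrivial Weyl solution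 at $Q$ has $f_1(y)=0$, then $Q$ is called a pole and $\mathcal X(Q)=\infty$. A functional $A$ of the continuous potential has functional derivatives $\frac{\delta A}{\delta\psi},\frac{\delta A}{\delta\overline\psi}\in L^1(\mathbb R)$ at $\psi$ if $$A(\psi+\varphi)=A(\psi)+\int_{\mathbb R}\Big(\frac{\delta A}{\delta\psi(x)}\varphi(x)+\frac{\delta A}{\delta\overline\psi(x)}\overline{\varphi(x)}\Big)dx+o(\|\varphi\|_\infty)$$ for bounded continuous $\varphi$ with $\|\varphi\|_\infty\to0$, and the classical bracket is $$\{A,B\}=2i\int_{\mathbb R}\Big(\frac{\delta A}{\delta\overline\psi(x)}\frac{\delta B}{\delta\psi(x)}-\frac{\delta A}{\delta\psi(x)}\frac{\delta B}{\delta\overline\psi(x)}\Big)dx .$$ Let $Q,P\in\Gamma$ be points that are not poles of the Weyl function of $\psi$. Then $\mathcal X(Q)$ and $\mathcal X(P)$, as functionals of the potential, have functional derivatives at $\psi$, the integral defining $\{\mathcal X(Q),\mathcal X(P)\}$ converges absolutely, and: i. if $Q,P\in\Gamma_R$ and $Q\ne P$, then $\displaystyle\{\mathcal X(Q),\mathcal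 X(P)\}=2\,\frac{(\mathcal X(Q)-\mathcal X(P))^2}{\lambda(Q)-\lambda(P)}$; ii. if $Q,P\in\Gamma_L$ and $Q\ne P$, then $\displaystyle\{\mathcal X(Q),\mathcal X(P)\}=-2\,\frac{(\mathcal X(Q)-\mathcal X(P))^2}{\lambda(Q)-\lambda(P)}$; iii. if $Q\in\Gamma_R$ and $P\in\Gamma_L$, then $\{\mathcal X(Q),\mathcal X(P)\}=0$. -/

import Mathlib

open scoped BoundedContinuousFunction

noncomputable section

namespace NLSWeyl

/-! ### The spectral cover -/

/-- The two sheets of the spectral cover. -/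
inductive Sheet
  | plus
  | minus

/-- A point `Q = (λ, ±)` of the spectral cover `Γ`: two copies of the complex plane without the
real line. -/
structure SpectralPoint where
  /-- the projection `λ(Q)` to the plane of the spectral parameter -/
  lam : ℂ
  /-- the sheet on which the point lies -/
  sheet : Sheet
  /-- the real line is removed -/
  im_ne_zero : lam.im ≠ 0

/-- The component `Γ_R` of the spectral cover. -/
def GammaR : Set SpectralPoint :=
  {Q | Q.sheet = Sheet.plus ∧ 0 < Q.lam.im} ∪ {Q | Q.sheet = Sheet.minus ∧ Q.lam.im < 0}

/-- The component `Γ_L` of the spectral cover. -/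
def GammaL : Set SpectralPoint :=
  {Q | Q.sheet = Sheet.plus ∧ Q.lam.im < 0} ∪ {Q | Q.sheet = Sheet.minus ∧ 0 < Q.lam.im}

/-! ### The Dirac spectral problem and the Weyl function -/

/-- The matrix `V(x, λ) = -(i λ / 2) σ₃ + Y₀(x)` of the linear problem `f' = V f` with the
continuous potential `ψ`. -/
def diracMatrix (ψ : C(ℝ, ℂ)) (l : ℂ) (x : ℝ) : Matrix (Fin 2) (Fin 2) ℂ :=
  !![-(Complex.I * l / 2), (starRingEnd ℂ) (ψ x);
     ψ x, Complex.I * l / 2]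

/-- `f` solves the linear problem `f'(x) = V(x, λ) f(x)` on the whole line. -/
def IsDiracSolution (ψ : C(ℝ, ℂ)) (l : ℂ) (f : ℝ → Fin 2 → ℂ) : Prop :=
  ∀ x : ℝ, HasDerivAt f ((diracMatrix ψ l x).mulVec (f x)) x

/-- `f` is a (not yet normalized, possibly zero) Weyl solution at `Q`: it solves the linear problem
with `λ = λ(Q)` and is square integrable on `[y, ∞)` if `Q ∈ Γ_R`, on `(-∞, y]` if `Q ∈ Γ_L`. -/
structure IsWeylSolution (ψ : C(ℝ, ℂ)) (y : ℝ) (Q : SpectralPoint) (f : ℝ → Fin 2 → ℂ) :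
    Prop where
  solves : IsDiracSolution ψ Q.lam f
  right : Q ∈ GammaR →
    MeasureTheory.IntegrableOn (fun x => ‖f x 0‖ ^ 2 + ‖f x 1‖ ^ 2) (Set.Ici y)
  left : Q ∈ GammaL →
    MeasureTheory.IntegrableOn (fun x => ‖f x 0‖ ^ 2 + ‖f x 1‖ ^ 2) (Set.Iic y)

/-- The Weyl function has a pole at `Q` (takes the value `∞` there): the first component of a
nontrivial Weyl solution vanishes at `y`, so that it cannot be normalized by `e₁(y) = 1`. -/
def IsWeylPole (ψ : C(ℝ, ℂ)) (y : ℝ) (Q : SpectralPoint) : Prop :=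
  ∃ f : ℝ → Fin 2 → ℂ, IsWeylSolution ψ y Q f ∧ f ≠ 0 ∧ f y 0 = 0

open Classical in
/-- The Weyl function `X(y, Q)` of the potential `ψ`: the number `X` such that the solution with
the value `(1, X)` at `x = y`, that is `M⁽¹⁾ + X M⁽²⁾` with `M(x, y, λ)` the transition matrix,
is the Weyl solution. The value `0` at poles is a dummy. -/
def weylFunction (ψ : C(ℝ, ℂ)) (y : ℝ) (Q : SpectralPoint) : ℂ :=
  if h : ∃ X : ℂ, ∃ f : ℝ → Fin 2 → ℂ, IsWeylSolution ψ y Q f ∧ f y = ![1, X] then h.choose else 0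

/-! ### Functional derivatives and the classical bracket -/

/-- The functional `A` on continuous potentials is Fréchet differentiable at `ψ` along bounded
continuous variations `φ` (with the supremum norm), with functional derivatives
`δA/δψ(x) = a x` and `δA/δψ̄(x) = b x`, that is
`A (ψ + φ) = A ψ + ∫ (a φ + b φ̄) dx + o(‖φ‖)`.
Such `a` and `b` are unique almost everywhere. -/
structure HasFunctionalDerivs (A : C(ℝ, ℂ) → ℂ) (ψ : C(ℝ, ℂ)) (a b : ℝ → ℂ) : Prop where
  integrable_fst : MeasureTheory.Integrable a
  integrable_snd : MeasureTheory.Integrable b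
  hasFDerivAt : ∃ D : (ℝ →ᵇ ℂ) →L[ℝ] ℂ,
    (∀ φ : ℝ →ᵇ ℂ, D φ = ∫ x, (a x * φ x + b x * (starRingEnd ℂ) (φ x))) ∧
    HasFDerivAt (fun φ : ℝ →ᵇ ℂ => A (ψ + φ.toContinuousMap)) D 0

/-- `A` has functional derivatives at `ψ`. -/
def FunctionallyDifferentiableAt (A : C(ℝ, ℂ) → ℂ) (ψ : C(ℝ, ℂ)) : Prop :=
  ∃ p : (ℝ → ℂ) × (ℝ → ℂ), HasFunctionalDerivs A ψ p.1 p.2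

open Classical in
/-- The pair `(δA/δψ, δA/δψ̄)` at `ψ`, with the dummy value `0` if it does not exist. -/
def functionalDerivs (A : C(ℝ, ℂ) → ℂ) (ψ : C(ℝ, ℂ)) : (ℝ → ℂ) × (ℝ → ℂ) :=
  if h : FunctionallyDifferentiableAt A ψ then h.choose else 0

/-- `δA/δψ̄ · δB/δψ - δA/δψ · δB/δψ̄`, the integrand of the classical bracket, at `ψ`. -/
def bracketDensity (A B : C(ℝ, ℂ) → ℂ) (ψ : C(ℝ, ℂ)) (x : ℝ) : ℂ :=
  (functionalDerivs A ψ).2 x * (functionalDerivs B ψ).1 x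
    - (functionalDerivs A ψ).1 x * (functionalDerivs B ψ).2 x

/-- The classical bracket `{A, B} = 2i ∫ (δA/δψ̄ · δB/δψ - δA/δψ · δB/δψ̄) dx` at `ψ`. -/
def nlsBracket (A B : C(ℝ, ℂ) → ℂ) (ψ : C(ℝ, ℂ)) : ℂ :=
  2 * Complex.I * ∫ x, bracketDensity A B ψ x

end NLSWeyl

end

/-! Two bilinear expressions in solutions carry the argument. For solutions `f`, `g` of the same
potential with parameters `l`, `m`, the Wronskian satisfies `W' = i(m - l)/2 · (f₁g₂ + f₂g₁)`; for
equal parameters and different potentials, `W'` is linear in the difference of the potentials. A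
function that is integrable on a half line together with its derivative tends to zero at infinity,
so integrating `W'` over the half line `H` leaves only the value at `y`.

Comparing the normalized Weyl solutions `f`, `g` of `ψ` and `χ = ψ + φ` in this way expresses the
change of the Weyl coefficient exactly as `s ∫_H (φ f₁g₁ - φ̄ f₂g₂)`. Replacing `g` by `f` gives the
functional derivatives `s f₁²` and `-s f₂²` on `H`, and zero off `H`
(`IsL2Solution.hasFunctionalDerivs`). For two points on the same side, the bracket density is then
`f₁²g₂² - f₂²g₁² = W · (f₁g₂ + f₂g₁)`, which is `(W²)'` divided by `i(m - l)`. Its integral is read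
off from `W(y)`, the difference of the two Weyl coefficients
(`IsL2Solution.integral_squaredDensity`). For points on opposite sides, the derivatives have
supports meeting only in `y`, so the density vanishes almost everywhere.

The estimates come from the indefinite form `f₁ḡ₁ - f₂ḡ₂`. The potential drops out of its
derivative, and this yields `|Im λ| ∫_H |f|² ≤ |f(y)|²` uniformly in the potential. Together with
compactness this bound gives existence of square integrable solutions (`exists_isL2Solution`). It
also shows that being no pole is stable and that `g` is within `O(√ε)` of `f` in `L²(H)`
(`IsL2Solution.exists_near`), so the error of the replacement is `O(ε^{3/2})`. No growth condition
on the potential is needed. -/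

noncomputable section

namespace NLSWeyl

/-! ### Global solutions of linear differential equations by Picard series. -/

section LinearODE

open MeasureTheory intervalIntegral Set
open scoped Interval

variable {𝕜 E : Type*} [RCLike 𝕜] [NormedAddCommGroup E] [NormedSpace 𝕜 E] [NormedSpace ℝ E]

/-- The terms of the Picard series of the linear equation `f' = A f` with `f y = v`. -/
def picardTerm (A : ℝ → E →L[𝕜] E) (y : ℝ) (v : E) : ℕ → ℝ → E
  | 0 => fun _ => v
  | n + 1 => fun x => ∫ t in y..x, A t (picardTerm A y v n t)

variable {A : ℝ → E →L[𝕜] E} {y : ℝ} {v : E}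

theorem continuous_picardTerm (hA : Continuous A) (n : ℕ) :
    Continuous (picardTerm A y v n) := by
  induction n with
  | zero => exact continuous_const
  | succ n ih =>
    exact intervalIntegral.continuous_primitive
      (fun a b => (hA.clm_apply ih).intervalIntegrable a b) y

theorem hasDerivAt_picardTerm_succ [CompleteSpace E] (hA : Continuous A) (n : ℕ) (x : ℝ) :
    HasDerivAt (picardTerm A y v (n + 1)) (A x (picardTerm A y v n x)) x :=
  (hA.clm_apply (continuous_picardTerm hA n)).integral_hasStrictDerivAt y x |>.hasDerivAt

/-- Each integration raises the power of `|x - y|` by one and divides by the new exponent. The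
resulting factorial makes the series converge on every bounded interval, however large `K` is. -/
theorem norm_picardTerm_le {R K : ℝ} (hK : ∀ x, |x - y| ≤ R → ‖A x‖ ≤ K) (n : ℕ) {x : ℝ}
    (hx : |x - y| ≤ R) :
    ‖picardTerm A y v n x‖ ≤ ‖v‖ * (K ^ n * |x - y| ^ n / n.factorial) := by
  induction n generalizing x with
  | zero => simp [picardTerm]
  | succ n ih =>
    have hK0 : 0 ≤ K := (norm_nonneg _).trans (hK x hx)
    have hsub : ∀ t ∈ Ι y x, |t - y| ≤ R := fun t ht =>
      (abs_sub_left_of_mem_uIcc (uIoc_subset_uIcc ht)).trans hx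
    calc ‖picardTerm A y v (n + 1) x‖
        ≤ ∫ t in Ι y x, ‖A t (picardTerm A y v n t)‖ := norm_integral_le_integral_norm_uIoc
      _ ≤ ∫ t in Ι y x, (K * (‖v‖ * (K ^ n / n.factorial))) * |t - y| ^ n := by
        refine integral_mono_of_nonneg (.of_forall fun _ => norm_nonneg _) ?_ ?_
        · exact (Continuous.integrableOn_uIcc (by fun_prop)).mono_set uIoc_subset_uIcc
        · refine (ae_restrict_mem measurableSet_uIoc).mono fun t ht => ?_
          calc ‖A t (picardTerm A y v n t)‖ ≤ ‖A t‖ * ‖picardTerm A y v n t‖ :=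
                ContinuousLinearMap.le_opNorm _ _
            _ ≤ K * (‖v‖ * (K ^ n * |t - y| ^ n / n.factorial)) :=
                mul_le_mul (hK t (hsub t ht)) (ih (hsub t ht)) (norm_nonneg _) hK0
            _ = _ := by ring
      _ = ‖v‖ * (K ^ (n + 1) * |x - y| ^ (n + 1) / (n + 1).factorial) := by
        rw [MeasureTheory.integral_const_mul, integral_pow_abs_sub_uIoc, Nat.factorial_succ]
        push_cast
        field_simp
        ring

/-- A linear differential equation with continuous coefficients has global solutions. -/
theorem exists_hasDerivAt_linear [CompleteSpace E] (hA : Continuous A) (y : ℝ) (v : E) :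
    ∃ f : ℝ → E, f y = v ∧ ∀ x, HasDerivAt f (A x (f x)) x := by
  have hbound : ∀ R : ℝ, ∃ K, 0 ≤ K ∧ ∀ x, |x - y| ≤ R → ‖A x‖ ≤ K := by
    intro R
    obtain ⟨K, hK⟩ := (isCompact_closedBall y R).exists_bound_of_continuousOn hA.continuousOn
    exact ⟨max K 0, le_max_right _ _, fun x hx => (hK x (by simpa [Real.dist_eq] using hx)).trans
      (le_max_left _ _)⟩
  have hterm : ∀ R K : ℝ, 0 ≤ K → (∀ x, |x - y| ≤ R → ‖A x‖ ≤ K) → ∀ n x, |x - y| ≤ R →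
      ‖picardTerm A y v n x‖ ≤ ‖v‖ * ((K * R) ^ n / n.factorial) := by
    intro R K h0 hK n x hx
    refine (norm_picardTerm_le hK n hx).trans ?_
    rw [mul_pow]
    gcongr
  have hsum : ∀ R K : ℝ, Summable fun n : ℕ => ‖v‖ * ((K * R) ^ n / n.factorial) := fun R K =>
    (Real.summable_pow_div_factorial _).mul_left _
  have hsummable : ∀ x, Summable fun n => picardTerm A y v n x := by
    intro x
    obtain ⟨K, h0, hK⟩ := hbound |x - y|
    exact .of_norm_bounded (hsum _ K) fun n => hterm _ K h0 hK n x le_rfl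
  refine ⟨fun x => ∑' n, picardTerm A y v n x, ?_, fun x => ?_⟩
  · change ∑' n, picardTerm A y v n y = v
    rw [tsum_eq_single 0]
    · rfl
    · intro n hn
      obtain ⟨m, rfl⟩ := Nat.exists_eq_succ_of_ne_zero hn
      simp [picardTerm]
  · obtain ⟨K, h0, hK⟩ := hbound (|x - y| + 1)
    have hxm : x ∈ Metric.ball y (|x - y| + 1) := by simp [Real.dist_eq]
    have hym : y ∈ Metric.ball y (|x - y| + 1) := by simp; positivity
    -- The constant term is left out, so that the derivative of term `n + 1` is `A` applied to term
    -- `n`; it is added back at the end. The radius `|x - y| + 1` gives an open ball containing both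
    -- `x` and `y`.
    have hd := hasDerivAt_tsum_of_isPreconnected (u := fun n => K * (‖v‖ * ((K * (|x - y| + 1)) ^ n /
        n.factorial))) (g := fun n x => picardTerm A y v (n + 1) x)
      (g' := fun n x => A x (picardTerm A y v n x)) ((hsum _ K).mul_left K) Metric.isOpen_ball
      (convex_ball y (|x - y| + 1)).isPreconnected
      (fun n t _ => hasDerivAt_picardTerm_succ hA n t)
      (fun n t ht => (ContinuousLinearMap.le_opNorm _ _).trans <|
        have ht' : |t - y| ≤ |x - y| + 1 := by
          rw [Metric.mem_ball, Real.dist_eq] at ht; exact ht.le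
        mul_le_mul (hK t ht') (hterm _ K h0 hK n t ht') (norm_nonneg _) h0) hym
      ((summable_nat_add_iff 1).2 (hsummable y)) hxm
    rw [← (A x).map_tsum (hsummable x)] at hd
    have hsplit : (fun x => ∑' n, picardTerm A y v n x) =
        fun x => v + ∑' n, picardTerm A y v (n + 1) x := by
      funext t
      rw [(hsummable t).tsum_eq_zero_add]
      rfl
    have := hd.const_add v
    rwa [← hsplit] at this

end LinearODE

/-- The Dirac problem has a solution with any given value at `y`. -/
theorem exists_isDiracSolution (ψ : C(ℝ, ℂ)) (l : ℂ) (y : ℝ) (v : Fin 2 → ℂ) :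
    ∃ f, IsDiracSolution ψ l f ∧ f y = v := by
  let L : Matrix (Fin 2) (Fin 2) ℂ →ₗ[ℂ] ((Fin 2 → ℂ) →L[ℂ] (Fin 2 → ℂ)) :=
    (LinearMap.toContinuousLinearMap.toLinearMap).comp
      (Matrix.toLin' (R := ℂ) (m := Fin 2) (n := Fin 2)).toLinearMap
  have hV : Continuous (diracMatrix ψ l) := by
    refine continuous_matrix fun i j => ?_
    fin_cases i <;> fin_cases j <;> simp only [diracMatrix] <;> simp <;> fun_prop
  obtain ⟨f, h0, hf⟩ := exists_hasDerivAt_linear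
    ((L.continuous_of_finiteDimensional).comp hV) y v
  exact ⟨f, fun x => by simpa [L] using hf x, h0⟩

/-! ### Wronskian and energy identities for square integrable solutions on a half line. -/

section SquareIntegrable

open MeasureTheory Set ComplexConjugate

/-- `H` is the half line `[y, ∞)` and `s = -1`, or `H = (-∞, y]` and `s = 1`. The sign is that of
the boundary term at `y` in the fundamental theorem of calculus on `H`. -/
def IsHalfLine (H : Set ℝ) (y s : ℝ) : Prop :=
  (H = Ici y ∧ s = -1) ∨ (H = Iic y ∧ s = 1)

variable {H : Set ℝ} {y s : ℝ}

theorem IsHalfLine.measurableSet (hH : IsHalfLine H y s) : MeasurableSet H := by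
  rcases hH with ⟨rfl, -⟩ | ⟨rfl, -⟩
  · exact measurableSet_Ici
  · exact measurableSet_Iic

theorem IsHalfLine.abs_sign (hH : IsHalfLine H y s) : |s| = 1 := by
  rcases hH with ⟨-, rfl⟩ | ⟨-, rfl⟩ <;> simp

theorem IsHalfLine.sign_mul_self (hH : IsHalfLine H y s) : s * s = 1 := by
  rcases hH with ⟨-, rfl⟩ | ⟨-, rfl⟩ <;> simp

/-- The fundamental theorem of calculus on a half line, for an integrable function with integrable
derivative. -/
theorem IsHalfLine.integral_deriv (hH : IsHalfLine H y s) {F F' : ℝ → ℂ}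
    (hF : ∀ x, HasDerivAt F (F' x) x) (hi : IntegrableOn F H) (hi' : IntegrableOn F' H) :
    ∫ x in H, F' x = s * F y := by
  rcases hH with ⟨rfl, rfl⟩ | ⟨rfl, rfl⟩
  · rw [integrableOn_Ici_iff_integrableOn_Ioi] at hi hi'
    rw [integral_Ici_eq_integral_Ioi, integral_Ioi_of_hasDerivAt_of_tendsto' (fun x _ => hF x) hi'
      (tendsto_zero_of_hasDerivAt_of_integrableOn_Ioi (fun x _ => hF x) hi' hi)]
    simp
  · rw [integral_Iic_of_hasDerivAt_of_tendsto' (fun x _ => hF x) hi'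
      (tendsto_zero_of_hasDerivAt_of_integrableOn_Iic (a := y) (fun x _ => hF x) hi' hi)]
    simp

/-- A function with integrable derivative, integrable itself, is bounded on the half line. -/
theorem IsHalfLine.exists_norm_le (hH : IsHalfLine H y s) {F F' : ℝ → ℂ}
    (hF : ∀ x, HasDerivAt F (F' x) x) (hi : IntegrableOn F H) (hi' : IntegrableOn F' H) :
    ∀ x ∈ H, ‖F x‖ ≤ ∫ t in H, ‖F' t‖ := by
  intro x hx
  -- The value at `x` is the boundary term of the half line that starts at `x` and points the same
  -- way.
  obtain ⟨H', hH', hsub⟩ : ∃ H', IsHalfLine H' x s ∧ H' ⊆ H := by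
    rcases hH with ⟨rfl, rfl⟩ | ⟨rfl, rfl⟩
    · exact ⟨Ici x, .inl ⟨rfl, rfl⟩, Ici_subset_Ici.2 hx⟩
    · exact ⟨Iic x, .inr ⟨rfl, rfl⟩, Iic_subset_Iic.2 hx⟩
  have h := hH'.integral_deriv hF (hi.mono_set hsub) (hi'.mono_set hsub)
  calc ‖F x‖ = ‖(s : ℂ) * F x‖ := by simp [hH.abs_sign]
    _ ≤ ∫ t in H', ‖F' t‖ := h ▸ norm_integral_le_integral_norm _
    _ ≤ ∫ t in H, ‖F' t‖ :=
      setIntegral_mono_set hi'.norm (.of_forall fun _ => norm_nonneg _) hsub.eventuallyLE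

/-- The squared Euclidean norm of the value of a spinor. -/
def sqNorm (f : ℝ → Fin 2 → ℂ) (x : ℝ) : ℝ := ‖f x 0‖ ^ 2 + ‖f x 1‖ ^ 2

/-- `f` is a solution of the Dirac problem which is square integrable on `H`. -/
structure IsL2Solution (ψ : C(ℝ, ℂ)) (l : ℂ) (H : Set ℝ) (f : ℝ → Fin 2 → ℂ) : Prop where
  solves : IsDiracSolution ψ l f
  integrableOn : IntegrableOn (sqNorm f) H

variable {ψ χ : C(ℝ, ℂ)} {l m : ℂ} {f g : ℝ → Fin 2 → ℂ}

theorem sqNorm_nonneg (f : ℝ → Fin 2 → ℂ) (x : ℝ) : 0 ≤ sqNorm f x := by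
  unfold sqNorm; positivity

theorem integral_sqNorm_nonneg (f : ℝ → Fin 2 → ℂ) (H : Set ℝ) : 0 ≤ ∫ x in H, sqNorm f x :=
  integral_nonneg fun _ => sqNorm_nonneg _ _

theorem IsDiracSolution.hasDerivAt_fst (hf : IsDiracSolution ψ l f) (x : ℝ) :
    HasDerivAt (fun x => f x 0) (-(Complex.I * l / 2) * f x 0 + conj (ψ x) * f x 1) x := by
  simpa [diracMatrix, Matrix.mulVec, dotProduct] using (hasDerivAt_pi.1 (hf x)) 0

theorem IsDiracSolution.hasDerivAt_snd (hf : IsDiracSolution ψ l f) (x : ℝ) :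
    HasDerivAt (fun x => f x 1) (ψ x * f x 0 + Complex.I * l / 2 * f x 1) x := by
  simpa [diracMatrix, Matrix.mulVec, dotProduct] using (hasDerivAt_pi.1 (hf x)) 1

@[fun_prop]
theorem IsDiracSolution.continuous (hf : IsDiracSolution ψ l f) : Continuous f :=
  continuous_iff_continuousAt.2 fun x => (hf x).continuousAt

theorem IsDiracSolution.const_smul (hf : IsDiracSolution ψ l f) (c : ℂ) :
    IsDiracSolution ψ l (c • f) := fun x => by
  simpa [Matrix.mulVec_smul] using (hf x).const_smul c

theorem IsDiracSolution.add (hf : IsDiracSolution ψ l f) (hg : IsDiracSolution ψ l g) :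
    IsDiracSolution ψ l (f + g) := fun x => by
  simpa [Matrix.mulVec_add] using (hf x).add (hg x)

theorem sqNorm_const_smul (c : ℂ) (f : ℝ → Fin 2 → ℂ) (x : ℝ) :
    sqNorm (c • f) x = ‖c‖ ^ 2 * sqNorm f x := by
  simp [sqNorm, mul_pow]; ring

theorem IsL2Solution.const_smul (hf : IsL2Solution ψ l H f) (c : ℂ) :
    IsL2Solution ψ l H (c • f) where
  solves := hf.solves.const_smul c
  integrableOn := by
    have : sqNorm (c • f) = fun x => ‖c‖ ^ 2 * sqNorm f x := funext (sqNorm_const_smul c f)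
    rw [this]
    exact Integrable.const_mul hf.integrableOn _

theorem norm_mul_le_sqNorm (f g : ℝ → Fin 2 → ℂ) (i j : Fin 2) (x : ℝ) :
    ‖f x i‖ * ‖g x j‖ ≤ sqNorm f x + sqNorm g x := by
  unfold sqNorm
  have h0 := sq_nonneg (‖f x i‖ - ‖g x j‖)
  fin_cases i <;> fin_cases j <;> simp only [Fin.zero_eta, Fin.mk_one] at * <;>
    nlinarith [sq_nonneg ‖f x 0‖, sq_nonneg ‖f x 1‖, sq_nonneg ‖g x 0‖, sq_nonneg ‖g x 1‖]

/-- Products of components of two square integrable solutions are integrable. -/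
theorem IsL2Solution.integrableOn_of_norm_le (hf : IsL2Solution ψ l H f)
    (hg : IsL2Solution χ m H g) {F : ℝ → ℂ} (hF : Continuous F) (C : ℝ)
    (h : ∀ x, ‖F x‖ ≤ C * (sqNorm f x + sqNorm g x)) : IntegrableOn F H :=
  Integrable.mono' (Integrable.const_mul (hf.integrableOn.add hg.integrableOn) C)
    hF.aestronglyMeasurable (.of_forall h)

/-- The Wronskian of two spinors. -/
def wronskian (f g : ℝ → Fin 2 → ℂ) (x : ℝ) : ℂ := f x 0 * g x 1 - f x 1 * g x 0

/-- The matrix of the problem has trace zero, so only differences of potentials and of parameters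
survive. Equal parameters give the variation of the Weyl coefficient, equal potentials give the
bracket. -/
theorem hasDerivAt_wronskian (hf : IsDiracSolution ψ l f) (hg : IsDiracSolution χ m g) (x : ℝ) :
    HasDerivAt (wronskian f g)
      ((χ x - ψ x) * (f x 0 * g x 0) - conj (χ x - ψ x) * (f x 1 * g x 1) +
        Complex.I * (m - l) / 2 * (f x 0 * g x 1 + f x 1 * g x 0)) x := by
  have := ((hf.hasDerivAt_fst x).mul (hg.hasDerivAt_snd x)).sub
    ((hf.hasDerivAt_snd x).mul (hg.hasDerivAt_fst x))
  convert! this using 1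
  rw [map_sub]
  ring

/-- The indefinite form conserved by the Dirac problem for real spectral parameters. -/
def pseudoInner (f g : ℝ → Fin 2 → ℂ) (x : ℝ) : ℂ := f x 0 * conj (g x 0) - f x 1 * conj (g x 1)

/-- The potential part of the matrix is skew for the form of signature (1,1), so a common potential
cancels and only `Im l` remains. Hence the bounds derived from it do not depend on the size of the
potential. -/
theorem hasDerivAt_pseudoInner (hf : IsDiracSolution ψ l f) (hg : IsDiracSolution χ l g) (x : ℝ) :
    HasDerivAt (pseudoInner f g)
      (l.im * (f x 0 * conj (g x 0) + f x 1 * conj (g x 1)) +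
        ((χ x - ψ x) * (f x 0 * conj (g x 1)) - conj (χ x - ψ x) * (f x 1 * conj (g x 0)))) x := by
  have := ((hf.hasDerivAt_fst x).mul (hg.hasDerivAt_fst x).star).sub
    ((hf.hasDerivAt_snd x).mul (hg.hasDerivAt_snd x).star)
  convert! this using 1
  have hl : Complex.I * conj l = Complex.I * l + 2 * l.im := by
    apply Complex.ext <;> simp
    ring
  simp only [Complex.star_def, map_add, map_mul, map_neg, map_sub, Complex.conj_I, map_div₀,
    Complex.conj_conj, map_ofNat]
  linear_combination (-1 / 2 : ℂ) *
    (f x 0 * conj (g x 0) + f x 1 * conj (g x 1)) * hl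

/-- The mass of a square integrable solution on the half line in terms of its value at the end
point. -/
theorem IsL2Solution.im_mul_integral (hH : IsHalfLine H y s) (hf : IsL2Solution ψ l H f) :
    l.im * ∫ x in H, sqNorm f x = s * (‖f y 0‖ ^ 2 - ‖f y 1‖ ^ 2) := by
  have hc := hf.solves.continuous
  have hd : ∀ x, HasDerivAt (pseudoInner f f) ((l.im * sqNorm f x : ℝ) : ℂ) x := fun x => by
    convert! hasDerivAt_pseudoInner hf.solves hf.solves x using 1
    simp [sqNorm, Complex.mul_conj']
  have h := hH.integral_deriv hd
    (hf.integrableOn_of_norm_le hf (by unfold pseudoInner; fun_prop) 1 fun x => by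
      refine (norm_sub_le _ _).trans ?_
      simp only [norm_mul, RCLike.norm_conj, sqNorm]
      nlinarith [sq_nonneg ‖f x 0‖, sq_nonneg ‖f x 1‖])
    (Integrable.ofReal (hf.integrableOn.const_mul _))
  rw [integral_complex_ofReal, integral_const_mul] at h
  have h2 : pseudoInner f f y = ((‖f y 0‖ ^ 2 - ‖f y 1‖ ^ 2 : ℝ) : ℂ) := by
    simp [pseudoInner, Complex.mul_conj']
  rw [h2] at h
  exact_mod_cast h

/-- This is the a priori bound: the value at `y` alone controls the mass, uniformly over all
potentials. -/
theorem IsL2Solution.abs_im_mul_integral_le (hH : IsHalfLine H y s) (hf : IsL2Solution ψ l H f) :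
    |l.im| * ∫ x in H, sqNorm f x ≤ sqNorm f y := by
  have h := congrArg abs (hf.im_mul_integral hH)
  rw [abs_mul, abs_mul, hH.abs_sign, one_mul, abs_of_nonneg (integral_sqNorm_nonneg f H)] at h
  rw [h, sqNorm, abs_le]
  constructor <;> nlinarith [sq_nonneg ‖f y 0‖, sq_nonneg ‖f y 1‖]

/-- The Wronskian at the end point of square integrable solutions for two potentials. -/
theorem IsL2Solution.integral_wronskian (hH : IsHalfLine H y s) (hf : IsL2Solution ψ l H f)
    (hg : IsL2Solution χ l H g) {ε : ℝ} (hε : ∀ x, ‖χ x - ψ x‖ ≤ ε) :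
    ∫ x in H, ((χ x - ψ x) * (f x 0 * g x 0) - conj (χ x - ψ x) * (f x 1 * g x 1)) =
      s * wronskian f g y := by
  have hc := hf.solves.continuous
  have hc' := hg.solves.continuous
  have hd : ∀ x, HasDerivAt (wronskian f g)
      ((χ x - ψ x) * (f x 0 * g x 0) - conj (χ x - ψ x) * (f x 1 * g x 1)) x := fun x => by
    convert! hasDerivAt_wronskian hf.solves hg.solves x using 1
    simp
  refine hH.integral_deriv hd
    (hf.integrableOn_of_norm_le hg (by unfold wronskian; fun_prop) 2 fun x => ?_)
    (hf.integrableOn_of_norm_le hg (by fun_prop) (2 * ε) fun x => ?_)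
  · refine (norm_sub_le _ _).trans ?_
    rw [norm_mul, norm_mul]
    linarith [norm_mul_le_sqNorm f g 0 1 x, norm_mul_le_sqNorm f g 1 0 x]
  · refine (norm_sub_le _ _).trans ?_
    simp only [norm_mul, RCLike.norm_conj]
    have h0 := mul_le_mul (hε x) (norm_mul_le_sqNorm f g 0 0 x) (by positivity)
      ((norm_nonneg _).trans (hε x))
    have h1 := mul_le_mul (hε x) (norm_mul_le_sqNorm f g 1 1 x) (by positivity)
      ((norm_nonneg _).trans (hε x))
    linarith

/-- The Wronskian at the end point is controlled by the distance of the potentials. -/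
theorem IsL2Solution.norm_wronskian_le (hH : IsHalfLine H y s) (hf : IsL2Solution ψ l H f)
    (hg : IsL2Solution χ l H g) {ε : ℝ} (hε : ∀ x, ‖χ x - ψ x‖ ≤ ε) :
    ‖wronskian f g y‖ ≤ ε * ((∫ x in H, sqNorm f x) + ∫ x in H, sqNorm g x) := by
  have h := hf.integral_wronskian hH hg hε
  have hε0 : 0 ≤ ε := (norm_nonneg _).trans (hε 0)
  calc ‖wronskian f g y‖ = ‖(s : ℂ) * wronskian f g y‖ := by simp [hH.abs_sign]
    _ ≤ ∫ x in H, ε * (sqNorm f x + sqNorm g x) := by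
      rw [← h]
      refine norm_integral_le_of_norm_le
        (Integrable.const_mul (hf.integrableOn.add hg.integrableOn) ε) (.of_forall fun x => ?_)
      refine (norm_sub_le _ _).trans ?_
      simp only [norm_mul, RCLike.norm_conj]
      have : ‖f x 0‖ * ‖g x 0‖ + ‖f x 1‖ * ‖g x 1‖ ≤ sqNorm f x + sqNorm g x := by
        unfold sqNorm
        nlinarith [sq_nonneg (‖f x 0‖ - ‖g x 0‖), sq_nonneg (‖f x 1‖ - ‖g x 1‖),
          sq_nonneg ‖f x 0‖, sq_nonneg ‖f x 1‖, sq_nonneg ‖g x 0‖, sq_nonneg ‖g x 1‖]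
      rw [← mul_add]
      exact mul_le_mul (hε x) this (by positivity) hε0
    _ = _ := by
      rw [integral_const_mul, integral_add hf.integrableOn hg.integrableOn]

theorem IsL2Solution.integrableOn_sub (hf : IsL2Solution ψ l H f) (hg : IsL2Solution χ m H g) :
    IntegrableOn (sqNorm (g - f)) H := by
  have hc := hf.solves.continuous
  have hc' := hg.solves.continuous
  refine Integrable.mono' (Integrable.const_mul (hf.integrableOn.add hg.integrableOn) 2)
    (Continuous.aestronglyMeasurable (by unfold sqNorm; simp only [Pi.sub_apply]; fun_prop))
    (.of_forall fun x => ?_)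
  rw [Real.norm_of_nonneg (sqNorm_nonneg _ _)]
  have h : ∀ i, ‖g x i - f x i‖ ^ 2 ≤ 2 * (‖f x i‖ ^ 2 + ‖g x i‖ ^ 2) := fun i => by
    have := norm_sub_le (g x i) (f x i)
    nlinarith [sq_nonneg (‖f x i‖ - ‖g x i‖), norm_nonneg (g x i - f x i)]
  simp only [sqNorm, Pi.sub_apply, Pi.add_apply]
  linarith [h 0, h 1]

/-- The distance in `L²(H)` of square integrable solutions for two potentials. -/
theorem IsL2Solution.abs_im_mul_integral_sub_le (hH : IsHalfLine H y s)
    (hf : IsL2Solution ψ l H f) (hg : IsL2Solution χ l H g) {ε : ℝ}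
    (hε : ∀ x, ‖χ x - ψ x‖ ≤ ε) :
    |l.im| * ∫ x in H, sqNorm (g - f) x ≤
      sqNorm (g - f) y + ε * ((∫ x in H, sqNorm f x) + ∫ x in H, sqNorm g x) := by
  have hc := hf.solves.continuous
  have hc' := hg.solves.continuous
  have hε0 : 0 ≤ ε := (norm_nonneg _).trans (hε 0)
  -- Expanding the form of `g - f` into four terms, only the two mixed ones pair solutions of
  -- different potentials; `R` collects what they leave.
  set R : ℝ → ℂ := fun x => (χ x - ψ x) * (g x 0 * conj (f x 1) - f x 0 * conj (g x 1)) -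
    conj (χ x - ψ x) * (g x 1 * conj (f x 0) - f x 1 * conj (g x 0)) with hR
  have hRle : ∀ x, ‖R x‖ ≤ ε * (sqNorm f x + sqNorm g x) := fun x => by
    have h1 : ‖g x 0 * conj (f x 1) - f x 0 * conj (g x 1)‖ ≤
        ‖g x 0‖ * ‖f x 1‖ + ‖f x 0‖ * ‖g x 1‖ := by
      refine (norm_sub_le _ _).trans ?_
      simp
    have h2 : ‖g x 1 * conj (f x 0) - f x 1 * conj (g x 0)‖ ≤
        ‖g x 1‖ * ‖f x 0‖ + ‖f x 1‖ * ‖g x 0‖ := by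
      refine (norm_sub_le _ _).trans ?_
      simp
    refine (norm_sub_le _ _).trans ?_
    rw [norm_mul, norm_mul, RCLike.norm_conj, ← mul_add]
    refine mul_le_mul (hε x) ?_ (by positivity) hε0
    unfold sqNorm
    nlinarith [sq_nonneg (‖g x 0‖ - ‖f x 1‖), sq_nonneg (‖g x 1‖ - ‖f x 0‖)]
  have hRi : IntegrableOn R H :=
    hf.integrableOn_of_norm_le hg (by fun_prop) ε hRle
  have hd : ∀ x, HasDerivAt (pseudoInner (g - f) (g - f))
      (((l.im * sqNorm (g - f) x : ℝ) : ℂ) + R x) x := fun x => by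
    have h := (((hasDerivAt_pseudoInner hg.solves hg.solves x).sub
      (hasDerivAt_pseudoInner hg.solves hf.solves x)).sub
      (hasDerivAt_pseudoInner hf.solves hg.solves x)).add
      (hasDerivAt_pseudoInner hf.solves hf.solves x)
    convert! h using 1
    · funext t
      simp only [pseudoInner, Pi.sub_apply, Pi.add_apply, map_sub]
      ring
    · simp only [sqNorm, Pi.sub_apply, hR]
      push_cast
      rw [← Complex.mul_conj', ← Complex.mul_conj']
      simp only [map_sub]
      ring
  have hint : IntegrableOn (sqNorm (g - f)) H := hf.integrableOn_sub hg
  have hint' : IntegrableOn (fun x => ((l.im * sqNorm (g - f) x : ℝ) : ℂ)) H :=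
    Integrable.ofReal (hint.const_mul _)
  have hnorm : ∀ x, ‖pseudoInner (g - f) (g - f) x‖ ≤ sqNorm (g - f) x := fun x => by
    refine (norm_sub_le _ _).trans ?_
    simp only [norm_mul, RCLike.norm_conj, sqNorm]
    exact le_of_eq (by ring)
  have h := hH.integral_deriv hd
    (Integrable.mono' hint (Continuous.aestronglyMeasurable
      (by unfold pseudoInner; simp only [Pi.sub_apply]; fun_prop)) (.of_forall hnorm))
    (hint'.add hRi)
  rw [integral_add hint' hRi, integral_complex_ofReal, integral_const_mul] at h
  have h3 : ‖((l.im * ∫ x in H, sqNorm (g - f) x : ℝ) : ℂ)‖ =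
      |l.im| * ∫ x in H, sqNorm (g - f) x := by
    rw [Complex.norm_real, Real.norm_eq_abs, abs_mul, abs_of_nonneg (integral_sqNorm_nonneg _ H)]
  have h4 : ‖∫ x in H, R x‖ ≤ ε * ((∫ x in H, sqNorm f x) + ∫ x in H, sqNorm g x) := by
    rw [← integral_add hf.integrableOn hg.integrableOn, ← integral_const_mul]
    exact norm_integral_le_of_norm_le
      (Integrable.const_mul (hf.integrableOn.add hg.integrableOn) ε) (.of_forall hRle)
  rw [← h3, eq_sub_of_add_eq h]
  refine (norm_sub_le _ _).trans (add_le_add ?_ h4)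
  rw [norm_mul, Complex.norm_real, Real.norm_eq_abs, hH.abs_sign, one_mul]
  exact hnorm y

end SquareIntegrable

/-! ### Existence of square integrable solutions and their stability under change of the potential.
-/

section Existence

open MeasureTheory Set ComplexConjugate Filter
open scoped Interval Topology

variable {H : Set ℝ} {y s : ℝ} {ψ χ : C(ℝ, ℂ)} {l : ℂ} {f g : ℝ → Fin 2 → ℂ}

theorem continuous_sqNorm (hf : Continuous f) : Continuous (sqNorm f) := by
  unfold sqNorm; fun_prop

/-- A continuous spinor of finite mass on the intervals from `y` exhausting the half line is square
integrable on the half line. -/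
theorem IsHalfLine.integrableOn_sqNorm (hH : IsHalfLine H y s) (hf : Continuous f) {C : ℝ}
    (h : ∀ n : ℕ, |∫ x in y..y - s * n, sqNorm f x| ≤ C) : IntegrableOn (sqNorm f) H := by
  have hc := continuous_sqNorm hf
  have hn : ∀ x, ‖sqNorm f x‖ = sqNorm f x := fun x => Real.norm_of_nonneg (sqNorm_nonneg f x)
  rcases hH with ⟨rfl, rfl⟩ | ⟨rfl, rfl⟩
  · rw [integrableOn_Ici_iff_integrableOn_Ioi]
    refine integrableOn_Ioi_of_intervalIntegral_norm_bounded C y (l := atTop)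
      (b := fun n : ℕ => y - (-1) * n) (fun n => ?_) ?_ (.of_forall fun n => ?_)
    · exact (hc.integrableOn_Icc).mono_set Ioc_subset_Icc_self
    · simp only [neg_one_mul, sub_neg_eq_add]
      exact tendsto_atTop_add_const_left _ _ tendsto_natCast_atTop_atTop
    · simp only [hn]
      exact (le_abs_self _).trans (h n)
  · refine integrableOn_Iic_of_intervalIntegral_norm_bounded C y (l := atTop)
      (a := fun n : ℕ => y - 1 * n) (fun n => ?_) ?_ (.of_forall fun n => ?_)
    · exact (hc.integrableOn_Icc).mono_set Ioc_subset_Icc_self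
    · simp only [one_mul, sub_eq_add_neg]
      exact tendsto_atBot_add_const_left _ _ (tendsto_neg_atTop_atBot.comp
        tendsto_natCast_atTop_atTop)
    · simp only [hn]
      rw [intervalIntegral.integral_symm]
      exact (neg_le_abs _).trans (h n)

theorem IsHalfLine.uIoc_subset (hH : IsHalfLine H y s) (n : ℕ) :
    Ι y (y - s * n) ⊆ Ι y (y - s * (n + 1 : ℕ)) := by
  have hn : (0 : ℝ) ≤ n := n.cast_nonneg
  push_cast
  rcases hH with ⟨-, rfl⟩ | ⟨-, rfl⟩
  · rw [uIoc_of_le (by linarith), uIoc_of_le (by linarith)]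
    exact Ioc_subset_Ioc_right (by linarith)
  · rw [uIoc_of_ge (by linarith), uIoc_of_ge (by linarith)]
    exact Ioc_subset_Ioc_left (by linarith)

/-- The mass on an interval of a solution whose components agree at the other end point. -/
theorem IsDiracSolution.abs_im_mul_intervalIntegral_le (hf : IsDiracSolution ψ l f) {T : ℝ}
    (hT : f T 0 = f T 1) : |l.im| * |∫ x in y..T, sqNorm f x| ≤ sqNorm f y := by
  have hd : ∀ x, HasDerivAt (pseudoInner f f) ((l.im * sqNorm f x : ℝ) : ℂ) x := fun x => by
    convert! hasDerivAt_pseudoInner hf hf x using 1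
    simp [sqNorm, Complex.mul_conj']
  have hc := continuous_sqNorm hf.continuous
  have h := intervalIntegral.integral_eq_sub_of_hasDerivAt (a := y) (b := T) (fun x _ => hd x)
    (Continuous.intervalIntegrable (by fun_prop) _ _)
  rw [intervalIntegral.integral_ofReal, intervalIntegral.integral_const_mul] at h
  -- The condition at `T` makes the form vanish there, so only the boundary term at `y` is left.
  have h0 : pseudoInner f f T = 0 := by simp [pseudoInner, hT]
  rw [h0, zero_sub] at h
  have := congrArg norm h
  rw [Complex.norm_real, norm_mul, norm_neg, Real.norm_eq_abs, Real.norm_eq_abs] at this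
  rw [this]
  refine (norm_sub_le _ _).trans ?_
  simp only [norm_mul, RCLike.norm_conj, sqNorm]
  exact le_of_eq (by ring)

theorem exists_smul_unit {w : Fin 2 → ℂ} (hw : w ≠ 0) :
    ∃ c : ℂ, c ≠ 0 ∧ ‖(c • w) 0‖ ^ 2 + ‖(c • w) 1‖ ^ 2 = 1 := by
  have hpos : 0 < ‖w 0‖ ^ 2 + ‖w 1‖ ^ 2 := by
    by_contra! hle
    have h0 : ‖w 0‖ = 0 := by nlinarith [sq_nonneg ‖w 0‖, sq_nonneg ‖w 1‖]
    have h1 : ‖w 1‖ = 0 := by nlinarith [sq_nonneg ‖w 0‖, sq_nonneg ‖w 1‖]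
    refine hw (funext fun i => ?_)
    fin_cases i
    · exact norm_eq_zero.1 h0
    · exact norm_eq_zero.1 h1
  refine ⟨((√(‖w 0‖ ^ 2 + ‖w 1‖ ^ 2))⁻¹ : ℝ), ?_, ?_⟩
  · exact Complex.ofReal_ne_zero.2 (inv_ne_zero (Real.sqrt_pos.2 hpos).ne')
  · simp only [Pi.smul_apply, smul_eq_mul, norm_mul, Complex.norm_real, norm_inv, mul_pow, inv_pow,
      Real.norm_eq_abs, sq_abs, Real.sq_sqrt hpos.le]
    field_simp

/-- Nontrivial square integrable solutions exist on every half line, for every nonreal spectral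
parameter. -/
theorem exists_isL2Solution (ψ : C(ℝ, ℂ)) (hl : l.im ≠ 0) (hH : IsHalfLine H y s) :
    ∃ f, IsL2Solution ψ l H f ∧ sqNorm f y = 1 := by
  obtain ⟨p, hp, hpy⟩ := exists_isDiracSolution ψ l y ![1, 0]
  obtain ⟨q, hq, hqy⟩ := exists_isDiracSolution ψ l y ![0, 1]
  have hpc := hp.continuous
  have hqc := hq.continuous
  set F : (Fin 2 → ℂ) → ℝ → Fin 2 → ℂ := fun v => v 0 • p + v 1 • q with hF
  have hFs : ∀ v, IsDiracSolution ψ l (F v) := fun v => (hp.const_smul _).add (hq.const_smul _)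
  have hFy : ∀ v, sqNorm (F v) y = ‖v 0‖ ^ 2 + ‖v 1‖ ^ 2 := fun v => by
    simp [hF, sqNorm, hpy, hqy]
  have hFc : ∀ T, Continuous fun v => ∫ x in y..T, sqNorm (F v) x := fun T => by
    refine intervalIntegral.continuous_parametric_intervalIntegral_of_continuous' ?_ _ _
    simp only [hF, sqNorm, Function.uncurry_def, Pi.add_apply, Pi.smul_apply]
    fun_prop
  have hlpos : 0 < |l.im| := abs_pos.2 hl
  -- Nested compact sets of unit initial values, playing the role of Weyl's disks. A common point
  -- has mass at most `1 / |l.im|` up to every cutoff.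
  let K : ℕ → Set (Fin 2 → ℂ) := fun n =>
    {v | ‖v 0‖ ^ 2 + ‖v 1‖ ^ 2 = 1} ∩ {v | |l.im| * |∫ x in y..y - s * n, sqNorm (F v) x| ≤ 1}
  have hKcl : ∀ n, IsClosed (K n) := fun n =>
    (isClosed_eq (by fun_prop) continuous_const).inter
      (isClosed_le ((hFc _).abs.const_mul _) continuous_const)
  have hK0 : IsCompact (K 0) := by
    refine (isCompact_closedBall (0 : Fin 2 → ℂ) 1).of_isClosed_subset (hKcl 0) ?_
    rintro v ⟨hv, -⟩
    rw [mem_ofPred_eq] at hv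
    rw [mem_closedBall_zero_iff, pi_norm_le_iff_of_nonneg zero_le_one]
    intro i
    fin_cases i <;> simp only [Fin.zero_eta, Fin.mk_one] <;>
      nlinarith [sq_nonneg ‖v 0‖, sq_nonneg ‖v 1‖]
  have hKsub : ∀ n, K (n + 1) ⊆ K n := by
    rintro n v ⟨hv, hv'⟩
    rw [mem_ofPred_eq] at hv'
    refine ⟨hv, ?_⟩
    rw [mem_ofPred_eq]
    refine le_trans ?_ hv'
    refine mul_le_mul_of_nonneg_left ?_ hlpos.le
    exact intervalIntegral.abs_integral_mono_interval (hH.uIoc_subset n)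
      (.of_forall fun x => sqNorm_nonneg _ _)
      ((continuous_sqNorm (hFs v).continuous).intervalIntegrable _ _)
  have hKne : ∀ n, (K n).Nonempty := by
    intro n
    set T := y - s * n
    -- Equality of the two components at `T` is one linear condition on two coefficients, so it has
    -- a nonzero solution.
    obtain ⟨w, hw, hwT⟩ : ∃ w : Fin 2 → ℂ, w ≠ 0 ∧
        w 0 * (p T 0 - p T 1) + w 1 * (q T 0 - q T 1) = 0 := by
      by_cases h : q T 0 - q T 1 = 0
      · exact ⟨![0, 1], fun h => by simpa using congrFun h 1, by simp [h]⟩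
      · exact ⟨![q T 0 - q T 1, -(p T 0 - p T 1)], fun h' => h (by simpa using congrFun h' 0),
          by simp; ring⟩
    obtain ⟨c, -, hcw⟩ := exists_smul_unit hw
    refine ⟨c • w, hcw, ?_⟩
    rw [mem_ofPred_eq, ← hcw, ← hFy]
    refine (hFs _).abs_im_mul_intervalIntegral_le ?_
    simp only [hF, Pi.add_apply, Pi.smul_apply, smul_eq_mul]
    linear_combination c * hwT
  obtain ⟨v, hv⟩ := IsCompact.nonempty_iInter_of_sequence_nonempty_isCompact_isClosed K hKsub hKne
    hK0 hKcl
  rw [mem_iInter] at hv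
  refine ⟨F v, ⟨hFs v, ?_⟩, (hFy v).trans (hv 0).1⟩
  refine hH.integrableOn_sqNorm (hFs v).continuous (C := 1 / |l.im|) fun n => ?_
  rw [le_div_iff₀' hlpos]
  exact (hv n).2

/-- Square integrable solutions for a potential near `ψ` are near the one for `ψ`, when both are
normalized by the value of the first component at `y`. -/
theorem IsL2Solution.exists_near (hl : l.im ≠ 0) (hH : IsHalfLine H y s)
    (hf : IsL2Solution ψ l H f) {X : ℂ} (hfy : f y = ![1, X]) :
    ∃ C ≥ 0, ∃ ε₀ > 0, ∀ (χ : C(ℝ, ℂ)) (ε : ℝ), ε ≤ ε₀ → (∀ x, ‖χ x - ψ x‖ ≤ ε) →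
      ∃ X' g, IsL2Solution χ l H g ∧ g y = ![1, X'] ∧ ∫ x in H, sqNorm (g - f) x ≤ C * ε := by
  set b := |l.im| with hb
  have hbpos : 0 < b := abs_pos.2 hl
  set M := ∫ x in H, sqNorm f x
  have hM : 0 ≤ M := integral_sqNorm_nonneg f H
  -- `G` will bound the mass of the normalized nearby solution: `1 / b` for a unit initial value,
  -- times the square of the normalizing factor.
  set G := (2 * (1 + ‖X‖)) ^ 2 / b with hG
  have hGpos : 0 < G := by positivity
  -- In the first constant, `(M + G) ^ 2` comes from the distance at `y` and `M + G` from the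
  -- potential difference. The threshold ensures `ε ^ 2 ≤ ε` and a Wronskian of norm at most `1 /
  -- 2`.
  refine ⟨((M + G) ^ 2 + (M + G)) / b, by positivity, min 1 (1 / (2 * (M + 1 / b))),
    by positivity, fun χ ε hεle hε => ?_⟩
  have hε0 : 0 ≤ ε := (norm_nonneg _).trans (hε 0)
  have hε1 : ε ≤ 1 := hεle.trans (min_le_left _ _)
  have hε2 : ε * (M + 1 / b) ≤ 1 / 2 := by
    have := hεle.trans (min_le_right _ _)
    rw [le_div_iff₀ (by positivity)] at this
    linarith
  obtain ⟨g, hg, hgy⟩ := exists_isL2Solution χ hl hH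
  have hgm : ∫ x in H, sqNorm g x ≤ 1 / b := by
    rw [le_div_iff₀' hbpos, ← hgy]
    exact hg.abs_im_mul_integral_le hH
  have hW := hf.norm_wronskian_le hH hg hε
  have hW' : ‖g y 1 - X * g y 0‖ ≤ 1 / 2 := by
    have : wronskian f g y = g y 1 - X * g y 0 := by simp [wronskian, hfy]
    rw [← this]
    refine hW.trans (le_trans ?_ hε2)
    gcongr
  -- A unit vector close to the line through `(1, X)` cannot have a small first component. Thus a
  -- nearby potential has no pole either.
  have hα : 1 ≤ ‖g y 0‖ * (2 * (1 + ‖X‖)) := by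
    have h1 : ‖g y 1‖ ≤ ‖X‖ * ‖g y 0‖ + 1 / 2 := by
      have := norm_add_le (g y 1 - X * g y 0) (X * g y 0)
      rw [sub_add_cancel, norm_mul] at this
      linarith
    have h2 : 1 ≤ ‖g y 0‖ + ‖g y 1‖ := by
      have : ‖g y 0‖ ^ 2 + ‖g y 1‖ ^ 2 = 1 := hgy
      nlinarith [norm_nonneg (g y 0), norm_nonneg (g y 1)]
    linarith
  have hα0 : g y 0 ≠ 0 := by
    intro h
    rw [h, norm_zero, zero_mul] at hα
    linarith
  have hαpos : 0 < ‖g y 0‖ := norm_pos_iff.2 hα0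
  set k := (g y 0)⁻¹ • g with hk
  have hkL : IsL2Solution χ l H k := hg.const_smul _
  have hky : k y = ![1, g y 1 / g y 0] := by
    funext i
    fin_cases i <;> simp [hk, hα0, div_eq_inv_mul]
  have hkm : ∫ x in H, sqNorm k x ≤ G := by
    simp only [hk, sqNorm_const_smul]
    rw [integral_const_mul, hG, ← mul_one_div]
    have : ‖(g y 0)⁻¹‖ ≤ 2 * (1 + ‖X‖) := by
      rw [norm_inv, inv_le_iff_one_le_mul₀ hαpos, mul_comm]
      exact hα
    have h0 := integral_sqNorm_nonneg g H
    gcongr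
  refine ⟨_, k, hkL, hky, ?_⟩
  have hsum : ε * (M + ∫ x in H, sqNorm k x) ≤ ε * (M + G) := by gcongr
  have hdy : sqNorm (k - f) y ≤ (ε * (M + G)) ^ 2 := by
    -- Both first components equal 1 at `y`, so the difference of the second ones is the Wronskian.
    have h1 : sqNorm (k - f) y = ‖wronskian f k y‖ ^ 2 := by
      simp [sqNorm, wronskian, hky, hfy]
    rw [h1]
    have := (hf.norm_wronskian_le hH hkL hε).trans hsum
    gcongr
  have hmain := hf.abs_im_mul_integral_sub_le hH hkL hε
  rw [div_mul_eq_mul_div, le_div_iff₀' hbpos]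
  have hsq : (ε * (M + G)) ^ 2 ≤ ε * (M + G) ^ 2 := by
    rw [mul_pow]
    have : ε ^ 2 ≤ ε := by nlinarith
    gcongr
  calc b * ∫ x in H, sqNorm (k - f) x ≤ _ := hmain
    _ ≤ ε * (M + G) ^ 2 + ε * (M + G) := add_le_add (hdy.trans hsq) hsum
    _ = _ := by ring

end Existence

/-! ### Uniqueness of functional derivatives and differentiability of the Weyl coefficient. -/

section FunctionalDerivative

open MeasureTheory Set ComplexConjugate Filter
open scoped Topology

/-- Functional derivatives are unique almost everywhere. -/
theorem HasFunctionalDerivs.ae_eq {A : C(ℝ, ℂ) → ℂ} {ψ : C(ℝ, ℂ)} {a b a' b' : ℝ → ℂ}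
    (h : HasFunctionalDerivs A ψ a b) (h' : HasFunctionalDerivs A ψ a' b') :
    a =ᵐ[volume] a' ∧ b =ᵐ[volume] b' := by
  obtain ⟨ha, hb, D, hD, hA⟩ := h
  obtain ⟨ha', hb', D', hD', hA'⟩ := h'
  obtain rfl : D = D' := hA.unique hA'
  have hmul : ∀ (u : ℝ → ℂ) (φ : ℝ →ᵇ ℂ), Integrable u → Integrable fun x => u x * φ x :=
    fun u φ hu => hu.mul_bdd (c := ‖φ‖) φ.continuous.aestronglyMeasurable
      (.of_forall φ.norm_coe_le_norm)
  have hmul' : ∀ (u : ℝ → ℂ) (φ : ℝ →ᵇ ℂ), Integrable u → Integrable fun x => u x * conj (φ x) :=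
    fun u φ hu => hu.mul_bdd (c := ‖φ‖)
      (Complex.continuous_conj.comp φ.continuous).aestronglyMeasurable
      (.of_forall fun x => by rw [RCLike.norm_conj]; exact φ.norm_coe_le_norm x)
  have key : ∀ φ : ℝ →ᵇ ℂ, ∫ x, ((a x - a' x) * φ x + (b x - b' x) * conj (φ x)) = 0 := by
    intro φ
    have := (hD φ).symm.trans (hD' φ)
    have h1 : Integrable fun x => a x * φ x + b x * conj (φ x) := (hmul a φ ha).add (hmul' b φ hb)
    have h2 : Integrable fun x => a' x * φ x + b' x * conj (φ x) :=
      (hmul a' φ ha').add (hmul' b' φ hb')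
    rw [← sub_eq_zero, ← integral_sub h1 h2] at this
    rw [← this]
    refine integral_congr_ae (.of_forall fun x => ?_)
    simp only
    ring
  -- Testing with `φ = c · g`, `g` real, yields one combination of the two differences for each `c`;
  -- the choices `1` and `i` separate them.
  have hzero : ∀ c : ℂ, ∀ᵐ x, c * (a x - a' x) + conj c * (b x - b' x) = 0 := by
    intro c
    refine ae_eq_zero_of_integral_contDiff_smul_eq_zero
      (((ha.sub ha').const_mul c).add ((hb.sub hb').const_mul (conj c))).locallyIntegrable ?_
    intro g hg hgc
    obtain ⟨C, hC⟩ := hgc.exists_bound_of_continuous hg.continuous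
    let φ : ℝ →ᵇ ℂ := BoundedContinuousFunction.ofNormedAddCommGroup (fun x => c * (g x : ℂ))
      (continuous_const.mul (Complex.continuous_ofReal.comp hg.continuous)) (‖c‖ * C) fun x => by
        rw [norm_mul, Complex.norm_real]
        exact mul_le_mul_of_nonneg_left (hC x) (norm_nonneg c)
    rw [← key φ]
    refine integral_congr_ae (.of_forall fun x => ?_)
    simp [φ]
    ring
  constructor
  · filter_upwards [hzero 1, hzero Complex.I] with x h1 h2
    simp only [map_one, one_mul, Complex.conj_I] at h1 h2
    linear_combination (1 / 2 : ℂ) * h1 - (Complex.I / 2) * h2 +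
      (1 / 2 : ℂ) * (a x - a' x - (b x - b' x)) * Complex.I_sq
  · filter_upwards [hzero 1, hzero Complex.I] with x h1 h2
    simp only [map_one, one_mul, Complex.conj_I] at h1 h2
    linear_combination (1 / 2 : ℂ) * h1 + (Complex.I / 2) * h2 -
      (1 / 2 : ℂ) * (a x - a' x - (b x - b' x)) * Complex.I_sq

/-- The pair in `functionalDerivs` is an arbitrary choice. Almost everywhere uniqueness allows the
bracket to be computed with any explicit pair. -/
theorem HasFunctionalDerivs.functionalDerivs_ae_eq {A : C(ℝ, ℂ) → ℂ} {ψ : C(ℝ, ℂ)}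
    {a b : ℝ → ℂ} (h : HasFunctionalDerivs A ψ a b) :
    (functionalDerivs A ψ).1 =ᵐ[volume] a ∧ (functionalDerivs A ψ).2 =ᵐ[volume] b := by
  have hex : FunctionallyDifferentiableAt A ψ := ⟨(a, b), h⟩
  rw [functionalDerivs, dif_pos hex]
  exact hex.choose_spec.ae_eq h

/-- The continuous linear functional with given integrable densities. -/
theorem exists_continuousLinearMap_integral {a b : ℝ → ℂ} (ha : Integrable a)
    (hb : Integrable b) : ∃ D : (ℝ →ᵇ ℂ) →L[ℝ] ℂ,
      ∀ φ : ℝ →ᵇ ℂ, D φ = ∫ x, (a x * φ x + b x * conj (φ x)) := by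
  have hint : ∀ φ : ℝ →ᵇ ℂ, Integrable fun x => a x * φ x + b x * conj (φ x) := fun φ =>
    (ha.mul_bdd (c := ‖φ‖) φ.continuous.aestronglyMeasurable
      (.of_forall φ.norm_coe_le_norm)).add
    (hb.mul_bdd (c := ‖φ‖) (Complex.continuous_conj.comp φ.continuous).aestronglyMeasurable
      (.of_forall fun x => by rw [RCLike.norm_conj]; exact φ.norm_coe_le_norm x))
  let L : (ℝ →ᵇ ℂ) →ₗ[ℝ] ℂ :=
    { toFun := fun φ => ∫ x, (a x * φ x + b x * conj (φ x))
      map_add' := fun φ η => by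
        rw [← integral_add (hint φ) (hint η)]
        refine integral_congr_ae (.of_forall fun x => ?_)
        simp
        ring
      map_smul' := fun c φ => by
        rw [RingHom.id_apply, ← integral_smul]
        refine integral_congr_ae (.of_forall fun x => ?_)
        simp
        ring }
  refine ⟨L.mkContinuous (∫ x, (‖a x‖ + ‖b x‖)) fun φ => ?_, fun φ => rfl⟩
  rw [← integral_mul_const]
  refine norm_integral_le_of_norm_le ((ha.norm.add hb.norm).mul_const _) (.of_forall fun x => ?_)
  refine (norm_add_le _ _).trans ?_
  rw [norm_mul, norm_mul, RCLike.norm_conj, ← add_mul]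
  exact mul_le_mul_of_nonneg_left (φ.norm_coe_le_norm x) (by positivity)

variable {H : Set ℝ} {y s : ℝ} {ψ χ : C(ℝ, ℂ)} {l : ℂ} {f g : ℝ → Fin 2 → ℂ}

theorem IsL2Solution.integrableOn_sq (hf : IsL2Solution ψ l H f) (i : Fin 2) :
    IntegrableOn (fun x => f x i ^ 2) H := by
  have hc := hf.solves.continuous
  refine hf.integrableOn_of_norm_le hf (by fun_prop) 1 fun x => ?_
  have := norm_mul_le_sqNorm f f i i x
  rw [norm_pow]
  linarith

/-- First order expansion of the Weyl coefficient, with an explicit remainder. -/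
theorem IsL2Solution.norm_sub_sub_le (hH : IsHalfLine H y s) (hf : IsL2Solution ψ l H f)
    (hg : IsL2Solution χ l H g) {X X' : ℂ} (hfy : f y = ![1, X]) (hgy : g y = ![1, X'])
    {ε C : ℝ} (hε : ∀ x, ‖χ x - ψ x‖ ≤ ε) (hC : ∫ x in H, sqNorm (g - f) x ≤ C * ε) :
    ‖X' - X - s * ∫ x in H, ((χ x - ψ x) * f x 0 ^ 2 - conj (χ x - ψ x) * f x 1 ^ 2)‖ ≤
      ((∫ x in H, sqNorm f x) + C) * (ε * √ε) := by
  have hfc := hf.solves.continuous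
  have hgc := hg.solves.continuous
  have hε0 : 0 ≤ ε := (norm_nonneg _).trans (hε 0)
  have hW := hf.integral_wronskian hH hg hε
  have hWy : wronskian f g y = X' - X := by simp [wronskian, hfy, hgy]
  rw [hWy] at hW
  have hss : (s : ℂ) * s = 1 := by exact_mod_cast hH.sign_mul_self
  have hX : X' - X = s * ∫ x in H, ((χ x - ψ x) * (f x 0 * g x 0) -
      conj (χ x - ψ x) * (f x 1 * g x 1)) := by
    rw [hW, ← mul_assoc, hss, one_mul]
  have hb : ∀ (k : ℝ → Fin 2 → ℂ) (i : Fin 2) x, ‖(χ x - ψ x) * (f x i * k x i)‖ ≤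
      ε * (sqNorm f x + sqNorm k x) := fun k i x => by
    rw [norm_mul, norm_mul]
    exact mul_le_mul (hε x) (norm_mul_le_sqNorm f k i i x) (by positivity) hε0
  have hb' : ∀ (k : ℝ → Fin 2 → ℂ) (i : Fin 2) x, ‖conj (χ x - ψ x) * (f x i * k x i)‖ ≤
      ε * (sqNorm f x + sqNorm k x) := fun k i x => by
    rw [norm_mul, RCLike.norm_conj, ← norm_mul]
    exact hb k i x
  have hi1 : IntegrableOn (fun x => (χ x - ψ x) * (f x 0 * g x 0) -
      conj (χ x - ψ x) * (f x 1 * g x 1)) H :=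
    Integrable.sub (hf.integrableOn_of_norm_le hg (by fun_prop) ε (hb g 0))
      (hf.integrableOn_of_norm_le hg (by fun_prop) ε (hb' g 1))
  have hi2 : IntegrableOn (fun x => (χ x - ψ x) * f x 0 ^ 2 -
      conj (χ x - ψ x) * f x 1 ^ 2) H := by
    simp only [sq]
    exact Integrable.sub (hf.integrableOn_of_norm_le hf (by fun_prop) ε (hb f 0))
      (hf.integrableOn_of_norm_le hf (by fun_prop) ε (hb' f 1))
  rw [hX, ← mul_sub, ← integral_sub hi1 hi2, norm_mul, Complex.norm_real, Real.norm_eq_abs,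
    hH.abs_sign, one_mul]
  have hsub := hf.integrableOn_sub hg
  -- The weight `√ε` balances the inequality between means: the mass of `g - f` is only `O(ε)`, and
  -- both terms of the bound become `O(ε^{3/2})`.
  set r := √ε with hr
  have hr0 : 0 ≤ r := Real.sqrt_nonneg _
  have hr2 : r * r = ε := Real.mul_self_sqrt hε0
  have hAG : ∀ x, ‖(χ x - ψ x) * (f x 0 * g x 0) - conj (χ x - ψ x) * (f x 1 * g x 1) -
      ((χ x - ψ x) * f x 0 ^ 2 - conj (χ x - ψ x) * f x 1 ^ 2)‖ ≤
      ε * r * sqNorm f x + r * sqNorm (g - f) x := fun x => by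
    have heq : (χ x - ψ x) * (f x 0 * g x 0) - conj (χ x - ψ x) * (f x 1 * g x 1) -
        ((χ x - ψ x) * f x 0 ^ 2 - conj (χ x - ψ x) * f x 1 ^ 2) =
        (χ x - ψ x) * (f x 0 * (g x 0 - f x 0)) -
          conj (χ x - ψ x) * (f x 1 * (g x 1 - f x 1)) := by ring
    rw [heq]
    refine (norm_sub_le _ _).trans ?_
    simp only [norm_mul, RCLike.norm_conj, sqNorm, Pi.sub_apply]
    rw [← mul_add, ← hr2]
    refine (mul_le_mul_of_nonneg_right ((hε x).trans_eq hr2.symm) (by positivity)).trans ?_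
    have h1 : ∀ u v : ℝ, r * u * v ≤ r * r * u ^ 2 + v ^ 2 := fun u v => by
      nlinarith [sq_nonneg (r * u - v), sq_nonneg (r * u), sq_nonneg v]
    have h2 := mul_le_mul_of_nonneg_left (add_le_add (h1 ‖f x 0‖ ‖g x 0 - f x 0‖)
      (h1 ‖f x 1‖ ‖g x 1 - f x 1‖)) hr0
    linarith
  calc _ ≤ ∫ x in H, (ε * r * sqNorm f x + r * sqNorm (g - f) x) :=
        norm_integral_le_of_norm_le ((hf.integrableOn.const_mul _).add (hsub.const_mul _))
          (.of_forall hAG)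
    _ = ε * r * (∫ x in H, sqNorm f x) + r * ∫ x in H, sqNorm (g - f) x := by
        rw [integral_add (hf.integrableOn.const_mul _) (hsub.const_mul _), integral_const_mul,
          integral_const_mul]
    _ ≤ ε * r * (∫ x in H, sqNorm f x) + r * (C * ε) := by gcongr
    _ = _ := by ring

/-- A functional reading off the normalized value at `y` of the solution which is square integrable
on the half line has functional derivatives quadratic in that solution. -/
theorem IsL2Solution.hasFunctionalDerivs (hl : l.im ≠ 0) (hH : IsHalfLine H y s)
    (hf : IsL2Solution ψ l H f) {X : ℂ} (hfy : f y = ![1, X]) {A : C(ℝ, ℂ) → ℂ}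
    (hA : ∀ (χ : C(ℝ, ℂ)) (g : ℝ → Fin 2 → ℂ) (X' : ℂ), IsL2Solution χ l H g → g y = ![1, X'] →
      A χ = X') :
    HasFunctionalDerivs A ψ (H.indicator fun x => s * f x 0 ^ 2)
      (H.indicator fun x => -s * f x 1 ^ 2) := by
  have hfc := hf.solves.continuous
  have ha : Integrable (H.indicator fun x => (s : ℂ) * f x 0 ^ 2) :=
    IntegrableOn.integrable_indicator (Integrable.const_mul (hf.integrableOn_sq 0) _) hH.measurableSet
  have hb : Integrable (H.indicator fun x => -(s : ℂ) * f x 1 ^ 2) :=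
    IntegrableOn.integrable_indicator (Integrable.const_mul (hf.integrableOn_sq 1) _) hH.measurableSet
  obtain ⟨D, hD⟩ := exists_continuousLinearMap_integral ha hb
  refine ⟨ha, hb, D, hD, ?_⟩
  have hD' : ∀ φ : ℝ →ᵇ ℂ, D φ = s * ∫ x in H, (φ x * f x 0 ^ 2 - conj (φ x) * f x 1 ^ 2) := by
    intro φ
    rw [hD, ← integral_const_mul, ← integral_indicator hH.measurableSet]
    refine integral_congr_ae (.of_forall fun x => ?_)
    by_cases hx : x ∈ H
    · simp only [indicator_of_mem hx]
      ring
    · simp [indicator_of_notMem hx]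
  obtain ⟨C, -, ε₀, hε₀, hnear⟩ := hf.exists_near hl hH hfy
  set B := (∫ x in H, sqNorm f x) + C
  have hbound : ∀ φ : ℝ →ᵇ ℂ, ‖φ‖ ≤ ε₀ →
      ‖A (ψ + φ.toContinuousMap) - A (ψ + (0 : ℝ →ᵇ ℂ).toContinuousMap) - D φ‖ ≤
        B * (‖φ‖ * √‖φ‖) := by
    intro φ hφ
    have hφ' : ∀ x, (ψ + φ.toContinuousMap) x - ψ x = φ x := fun x => by simp
    have hφn : ∀ x, ‖(ψ + φ.toContinuousMap) x - ψ x‖ ≤ ‖φ‖ := fun x => by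
      rw [hφ']
      exact φ.norm_coe_le_norm x
    obtain ⟨X', g, hg, hgy, hgm⟩ := hnear _ _ hφ hφn
    have h0 : ψ + (0 : ℝ →ᵇ ℂ).toContinuousMap = ψ := by ext; simp
    rw [h0, hA _ _ _ hg hgy, hA _ _ _ hf hfy, hD']
    simpa only [hφ'] using hf.norm_sub_sub_le hH hg hfy hgy hφn hgm
  rw [hasFDerivAt_iff_isLittleO_nhds_zero, Asymptotics.isLittleO_iff]
  intro c hc
  have ht : Tendsto (fun φ : ℝ →ᵇ ℂ => B * √‖φ‖) (𝓝 0) (𝓝 0) := by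
    have : Continuous fun φ : ℝ →ᵇ ℂ => B * √‖φ‖ := by fun_prop
    simpa using this.tendsto 0
  filter_upwards [ht.eventually_lt_const hc, Metric.closedBall_mem_nhds (0 : ℝ →ᵇ ℂ) hε₀]
    with φ h1 h2
  rw [zero_add]
  calc _ ≤ B * (‖φ‖ * √‖φ‖) := hbound φ (by simpa using h2)
    _ = (B * √‖φ‖) * ‖φ‖ := by ring
    _ ≤ c * ‖φ‖ := by gcongr

end FunctionalDerivative

/-! ### The bracket density as a total derivative, and the brackets of Weyl functions. -/

section Bracket

open MeasureTheory Set ComplexConjugate Filter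

variable {H : Set ℝ} {y s : ℝ} {ψ : C(ℝ, ℂ)} {l m : ℂ} {f g : ℝ → Fin 2 → ℂ}

/-- The density `f₁² g₂² - f₂² g₁²` of the bracket of two Weyl coefficients. -/
def squaredDensity (f g : ℝ → Fin 2 → ℂ) (x : ℝ) : ℂ :=
  wronskian f g x * (f x 0 * g x 1 + f x 1 * g x 0)

theorem norm_cross_le (f g : ℝ → Fin 2 → ℂ) (x : ℝ) :
    ‖f x 0 * g x 1 + f x 1 * g x 0‖ ≤ 2 * (sqNorm f x + sqNorm g x) := by
  refine (norm_add_le _ _).trans ?_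
  rw [norm_mul, norm_mul]
  linarith [norm_mul_le_sqNorm f g 0 1 x, norm_mul_le_sqNorm f g 1 0 x]

theorem norm_wronskian_apply_le (f g : ℝ → Fin 2 → ℂ) (x : ℝ) :
    ‖wronskian f g x‖ ≤ 2 * (sqNorm f x + sqNorm g x) := by
  refine (norm_sub_le _ _).trans ?_
  rw [norm_mul, norm_mul]
  linarith [norm_mul_le_sqNorm f g 0 1 x, norm_mul_le_sqNorm f g 1 0 x]

theorem continuous_wronskian (hf : Continuous f) (hg : Continuous g) :
    Continuous (wronskian f g) := by
  unfold wronskian; fun_prop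

theorem IsL2Solution.hasDerivAt_wronskian (hf : IsL2Solution ψ l H f)
    (hg : IsL2Solution ψ m H g) (x : ℝ) :
    HasDerivAt (wronskian f g)
      (Complex.I * (m - l) / 2 * (f x 0 * g x 1 + f x 1 * g x 0)) x := by
  simpa using NLSWeyl.hasDerivAt_wronskian hf.solves hg.solves x

theorem IsL2Solution.integrableOn_cross (hf : IsL2Solution ψ l H f)
    (hg : IsL2Solution ψ m H g) :
    IntegrableOn (fun x => f x 0 * g x 1 + f x 1 * g x 0) H := by
  have hfc := hf.solves.continuous
  have hgc := hg.solves.continuous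
  exact hf.integrableOn_of_norm_le hg (by fun_prop) 2 (norm_cross_le f g)

theorem IsL2Solution.integrableOn_wronskian (hf : IsL2Solution ψ l H f)
    (hg : IsL2Solution ψ m H g) : IntegrableOn (wronskian f g) H :=
  hf.integrableOn_of_norm_le hg (continuous_wronskian hf.solves.continuous hg.solves.continuous) 2
    (norm_wronskian_apply_le f g)

/-- The bracket density is quartic in the solutions, while square integrability directly controls
only quadratic products. The gap is closed because the Wronskian, integrable with integrable
derivative, is bounded on `H`. -/
theorem IsL2Solution.integrableOn_wronskian_mul (hH : IsHalfLine H y s)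
    (hf : IsL2Solution ψ l H f) (hg : IsL2Solution ψ m H g) {F : ℝ → ℂ}
    (hF : IntegrableOn F H) : IntegrableOn (fun x => wronskian f g x * F x) H :=
  Integrable.bdd_mul hF
    (continuous_wronskian hf.solves.continuous hg.solves.continuous).aestronglyMeasurable
    ((ae_restrict_mem hH.measurableSet).mono fun x hx =>
      hH.exists_norm_le (hf.hasDerivAt_wronskian hg) (hf.integrableOn_wronskian hg)
        ((hf.integrableOn_cross hg).const_mul _) x hx)

theorem IsL2Solution.integrableOn_squaredDensity (hH : IsHalfLine H y s)
    (hf : IsL2Solution ψ l H f) (hg : IsL2Solution ψ m H g) :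
    IntegrableOn (squaredDensity f g) H :=
  hf.integrableOn_wronskian_mul hH hg (hf.integrableOn_cross hg)

/-- Up to the factor `i(m - l)` the density is the derivative of the squared Wronskian, which
vanishes at infinity. -/
theorem IsL2Solution.integral_squaredDensity (hH : IsHalfLine H y s)
    (hf : IsL2Solution ψ l H f) (hg : IsL2Solution ψ m H g) :
    Complex.I * (m - l) * ∫ x in H, squaredDensity f g x = s * wronskian f g y ^ 2 := by
  have hd : ∀ x, HasDerivAt (fun x => wronskian f g x * wronskian f g x)
      (Complex.I * (m - l) * squaredDensity f g x) x := fun x => by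
    convert! (hf.hasDerivAt_wronskian hg x).mul (hf.hasDerivAt_wronskian hg x) using 1
    rw [squaredDensity]
    ring
  rw [← integral_const_mul, hH.integral_deriv hd
    (hf.integrableOn_wronskian_mul hH hg (hf.integrableOn_wronskian hg))
    ((hf.integrableOn_squaredDensity hH hg).const_mul _), sq]

theorem mem_GammaL_iff_notMem_GammaR (Q : SpectralPoint) : Q ∈ GammaL ↔ Q ∉ GammaR := by
  obtain ⟨l, σ, h⟩ := Q
  rcases lt_or_gt_of_ne h with h | h <;> cases σ <;>
    simp [GammaL, GammaR, h, h.le]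

theorem isWeylSolution_iff_of_mem_GammaR {Q : SpectralPoint} (hQ : Q ∈ GammaR) :
    IsWeylSolution ψ y Q f ↔ IsL2Solution ψ Q.lam (Ici y) f :=
  ⟨fun h => ⟨h.solves, h.right hQ⟩, fun h => ⟨h.solves, fun _ => h.integrableOn,
    fun hL => absurd hQ ((mem_GammaL_iff_notMem_GammaR Q).1 hL)⟩⟩

theorem isWeylSolution_iff_of_mem_GammaL {Q : SpectralPoint} (hQ : Q ∈ GammaL) :
    IsWeylSolution ψ y Q f ↔ IsL2Solution ψ Q.lam (Iic y) f :=
  ⟨fun h => ⟨h.solves, h.left hQ⟩, fun h => ⟨h.solves,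
    fun hR => absurd hR ((mem_GammaL_iff_notMem_GammaR Q).1 hQ), fun _ => h.integrableOn⟩⟩

/-- At a point which is not a pole the Weyl function is realized by a normalized Weyl solution, whose
squared components are the functional derivatives. -/
theorem exists_weylSolution {Q : SpectralPoint} (hH : IsHalfLine H y s)
    (hQH : ∀ ψ f, IsWeylSolution ψ y Q f ↔ IsL2Solution ψ Q.lam H f) (hQ : ¬ IsWeylPole ψ y Q) :
    ∃ f, IsL2Solution ψ Q.lam H f ∧ f y = ![1, weylFunction ψ y Q] ∧
      HasFunctionalDerivs (fun χ => weylFunction χ y Q) ψ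
        (H.indicator fun x => s * f x 0 ^ 2) (H.indicator fun x => -s * f x 1 ^ 2) := by
  have hval : ∀ (χ : C(ℝ, ℂ)) (g : ℝ → Fin 2 → ℂ) (X : ℂ), IsL2Solution χ Q.lam H g →
      g y = ![1, X] → weylFunction χ y Q = X := by
    intro χ g X hg hgy
    have hex : ∃ X : ℂ, ∃ f : ℝ → Fin 2 → ℂ, IsWeylSolution χ y Q f ∧ f y = ![1, X] :=
      ⟨X, g, (hQH _ _).2 hg, hgy⟩
    rw [weylFunction, dif_pos hex]
    obtain ⟨f, hf, hfy⟩ := hex.choose_spec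
    -- For one potential the bound with `ε = 0` makes the Wronskian vanish at `y`, so the Weyl
    -- coefficient is unique and the chosen value is `X`.
    have h := ((hQH _ _).1 hf).norm_wronskian_le hH hg (ε := 0) (by simp)
    rw [zero_mul, norm_le_zero_iff] at h
    simp only [wronskian, hfy, hgy] at h
    simpa using (sub_eq_zero.1 h).symm
  obtain ⟨f, hf, hfy⟩ := exists_isL2Solution ψ Q.im_ne_zero hH
  have h0 : f y 0 ≠ 0 := fun h0 => hQ ⟨f, (hQH _ _).2 hf, fun h => by simp [h, sqNorm] at hfy, h0⟩
  have hk := hf.const_smul (f y 0)⁻¹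
  have hky : ((f y 0)⁻¹ • f) y = ![1, f y 1 / f y 0] := by
    funext i
    fin_cases i <;> simp [h0, div_eq_inv_mul]
  refine ⟨_, hk, ?_, hk.hasFunctionalDerivs Q.im_ne_zero hH hky hval⟩
  rw [hky, hval _ _ _ hk hky]

/-- The bracket of the Weyl functions at two points with Weyl solutions on the same half line. -/
theorem bracket_same_side {Q P : SpectralPoint} (hH : IsHalfLine H y s)
    (hQH : ∀ ψ f, IsWeylSolution ψ y Q f ↔ IsL2Solution ψ Q.lam H f)
    (hPH : ∀ ψ f, IsWeylSolution ψ y P f ↔ IsL2Solution ψ P.lam H f)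
    (hQ : ¬ IsWeylPole ψ y Q) (hP : ¬ IsWeylPole ψ y P) :
    (FunctionallyDifferentiableAt (fun χ => weylFunction χ y Q) ψ ∧
      FunctionallyDifferentiableAt (fun χ => weylFunction χ y P) ψ ∧
      Integrable (bracketDensity (fun χ => weylFunction χ y Q)
        (fun χ => weylFunction χ y P) ψ)) ∧
    (Q.lam ≠ P.lam →
      nlsBracket (fun χ => weylFunction χ y Q) (fun χ => weylFunction χ y P) ψ =
        -2 * s * ((weylFunction ψ y Q - weylFunction ψ y P) ^ 2 / (Q.lam - P.lam))) := by
  obtain ⟨f, hf, hfy, hfd⟩ := exists_weylSolution hH hQH hQ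
  obtain ⟨g, hg, hgy, hgd⟩ := exists_weylSolution hH hPH hP
  have hss : (s : ℂ) * s = 1 := by exact_mod_cast hH.sign_mul_self
  have hae : bracketDensity (fun χ => weylFunction χ y Q) (fun χ => weylFunction χ y P) ψ
      =ᵐ[volume] H.indicator (squaredDensity f g) := by
    filter_upwards [hfd.functionalDerivs_ae_eq.1, hfd.functionalDerivs_ae_eq.2,
      hgd.functionalDerivs_ae_eq.1, hgd.functionalDerivs_ae_eq.2] with x h1 h2 h3 h4
    rw [bracketDensity, h1, h2, h3, h4]
    by_cases hx : x ∈ H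
    · simp only [indicator_of_mem hx, squaredDensity, wronskian]
      linear_combination (f x 0 ^ 2 * g x 1 ^ 2 - f x 1 ^ 2 * g x 0 ^ 2) * hss
    · simp [indicator_of_notMem hx]
  refine ⟨⟨⟨(_, _), hfd⟩, ⟨(_, _), hgd⟩, (integrable_congr hae).2
    ((hf.integrableOn_squaredDensity hH hg).integrable_indicator hH.measurableSet)⟩, fun hne => ?_⟩
  rw [nlsBracket, integral_congr_ae hae, integral_indicator hH.measurableSet]
  have h := hf.integral_squaredDensity hH hg
  have hW : wronskian f g y = weylFunction ψ y P - weylFunction ψ y Q := by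
    simp [wronskian, hfy, hgy]
  rw [hW] at h
  have hne' : Q.lam - P.lam ≠ 0 := sub_ne_zero.2 hne
  rw [← mul_div_assoc, eq_div_iff hne']
  -- The factor `i` of the bracket combines with `i(m - l)`; the minus sign turns `m - l` into `l -
  -- m`.
  linear_combination -2 * h

/-- The bracket of the Weyl functions at two points with Weyl solutions on opposite half lines. -/
theorem bracket_opposite_sides {H' : Set ℝ} {s' : ℝ} {Q P : SpectralPoint}
    (hH : IsHalfLine H y s) (hH' : IsHalfLine H' y s') (hHH' : H ∩ H' ⊆ {y})
    (hQH : ∀ ψ f, IsWeylSolution ψ y Q f ↔ IsL2Solution ψ Q.lam H f)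
    (hPH : ∀ ψ f, IsWeylSolution ψ y P f ↔ IsL2Solution ψ P.lam H' f)
    (hQ : ¬ IsWeylPole ψ y Q) (hP : ¬ IsWeylPole ψ y P) :
    (FunctionallyDifferentiableAt (fun χ => weylFunction χ y Q) ψ ∧
      FunctionallyDifferentiableAt (fun χ => weylFunction χ y P) ψ ∧
      Integrable (bracketDensity (fun χ => weylFunction χ y Q)
        (fun χ => weylFunction χ y P) ψ)) ∧
    nlsBracket (fun χ => weylFunction χ y Q) (fun χ => weylFunction χ y P) ψ = 0 := by
  obtain ⟨f, hf, hfy, hfd⟩ := exists_weylSolution hH hQH hQ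
  obtain ⟨g, hg, hgy, hgd⟩ := exists_weylSolution hH' hPH hP
  have hae : bracketDensity (fun χ => weylFunction χ y Q) (fun χ => weylFunction χ y P) ψ
      =ᵐ[volume] 0 := by
    -- The common end point `y`, where both indicators may be nonzero, is discarded as a null set.
    filter_upwards [hfd.functionalDerivs_ae_eq.1, hfd.functionalDerivs_ae_eq.2,
      hgd.functionalDerivs_ae_eq.1, hgd.functionalDerivs_ae_eq.2,
      Measure.ae_ne volume y] with x h1 h2 h3 h4 hx
    rw [bracketDensity, h1, h2, h3, h4]
    by_cases hxH : x ∈ H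
    · have hxH' : x ∉ H' := fun h => hx (hHH' ⟨hxH, h⟩)
      simp [indicator_of_notMem hxH']
    · simp [indicator_of_notMem hxH]
  refine ⟨⟨⟨(_, _), hfd⟩, ⟨(_, _), hgd⟩, (integrable_congr hae).2 (integrable_zero _ _ _)⟩, ?_⟩
  rw [nlsBracket, integral_congr_ae hae]
  simp

/-- Within one component the sign of `Im λ` determines the sheet. Distinct points of a component
therefore have distinct parameters, and the denominators do not vanish. -/
theorem SpectralPoint.eq_of_lam_eq {Q P : SpectralPoint} (hside : Q ∈ GammaR ↔ P ∈ GammaR)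
    (h : Q.lam = P.lam) : Q = P := by
  obtain ⟨l, σ, hl⟩ := Q
  obtain ⟨m, τ, hm⟩ := P
  obtain rfl : l = m := h
  rcases lt_or_gt_of_ne hl with h | h <;> cases σ <;> cases τ <;>
    simp_all [GammaR, h.not_gt]

end Bracket

end NLSWeyl

end

theorem theorem4p1 (ψ : C(ℝ, ℂ)) (y : ℝ) (Q P : NLSWeyl.SpectralPoint)
    (hQ : ¬ NLSWeyl.IsWeylPole ψ y Q) (hP : ¬ NLSWeyl.IsWeylPole ψ y P) :
    -- the bracket is well defined
    (NLSWeyl.FunctionallyDifferentiableAt (fun χ => NLSWeyl.weylFunction χ y Q) ψ ∧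
      NLSWeyl.FunctionallyDifferentiableAt (fun χ => NLSWeyl.weylFunction χ y P) ψ ∧
      MeasureTheory.Integrable (NLSWeyl.bracketDensity (fun χ => NLSWeyl.weylFunction χ y Q)
        (fun χ => NLSWeyl.weylFunction χ y P) ψ)) ∧
    -- both points in the right component
    (Q ∈ NLSWeyl.GammaR → P ∈ NLSWeyl.GammaR → Q ≠ P →
      NLSWeyl.nlsBracket (fun χ => NLSWeyl.weylFunction χ y Q)
          (fun χ => NLSWeyl.weylFunction χ y P) ψ =
        2 * ((NLSWeyl.weylFunction ψ y Q - NLSWeyl.weylFunction ψ y P) ^ 2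
          / (Q.lam - P.lam))) ∧
    -- both points in the left component
    (Q ∈ NLSWeyl.GammaL → P ∈ NLSWeyl.GammaL → Q ≠ P →
      NLSWeyl.nlsBracket (fun χ => NLSWeyl.weylFunction χ y Q)
          (fun χ => NLSWeyl.weylFunction χ y P) ψ =
        -2 * ((NLSWeyl.weylFunction ψ y Q - NLSWeyl.weylFunction ψ y P) ^ 2
          / (Q.lam - P.lam))) ∧
    -- points in different components
    (Q ∈ NLSWeyl.GammaR → P ∈ NLSWeyl.GammaL →
      NLSWeyl.nlsBracket (fun χ => NLSWeyl.weylFunction χ y Q)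
          (fun χ => NLSWeyl.weylFunction χ y P) ψ = 0) := by
  have hmem := NLSWeyl.mem_GammaL_iff_notMem_GammaR
  have hR : NLSWeyl.IsHalfLine (Set.Ici y) y (-1) := .inl ⟨rfl, rfl⟩
  have hL : NLSWeyl.IsHalfLine (Set.Iic y) y 1 := .inr ⟨rfl, rfl⟩
  by_cases hQR : Q ∈ NLSWeyl.GammaR <;> by_cases hPR : P ∈ NLSWeyl.GammaR
  · have h := NLSWeyl.bracket_same_side hR
      (fun _ _ => NLSWeyl.isWeylSolution_iff_of_mem_GammaR hQR)
      (fun _ _ => NLSWeyl.isWeylSolution_iff_of_mem_GammaR hPR) hQ hP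
    refine ⟨h.1, fun _ _ hne => ?_, fun hQL => absurd hQR ((hmem Q).1 hQL),
      fun _ hPL => absurd hPR ((hmem P).1 hPL)⟩
    rw [h.2 fun hlam => hne (NLSWeyl.SpectralPoint.eq_of_lam_eq (iff_of_true hQR hPR) hlam)]
    norm_num
  · have hPL := (hmem P).2 hPR
    have h := NLSWeyl.bracket_opposite_sides hR hL (fun x hx => le_antisymm hx.2 hx.1)
      (fun _ _ => NLSWeyl.isWeylSolution_iff_of_mem_GammaR hQR)
      (fun _ _ => NLSWeyl.isWeylSolution_iff_of_mem_GammaL hPL) hQ hP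
    exact ⟨h.1, fun _ hP' => absurd hP' hPR, fun hQL => absurd hQR ((hmem Q).1 hQL),
      fun _ _ => h.2⟩
  -- None of the three formulas concerns this configuration; only the well-definedness of the
  -- bracket is needed from it.
  · have hQL := (hmem Q).2 hQR
    have h := NLSWeyl.bracket_opposite_sides hL hR (fun x hx => le_antisymm hx.1 hx.2)
      (fun _ _ => NLSWeyl.isWeylSolution_iff_of_mem_GammaL hQL)
      (fun _ _ => NLSWeyl.isWeylSolution_iff_of_mem_GammaR hPR) hQ hP
    exact ⟨h.1, fun hQ' => absurd hQ' hQR, fun _ hPL => absurd hPR ((hmem P).1 hPL),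
      fun hQ' => absurd hQ' hQR⟩
  · have hQL := (hmem Q).2 hQR
    have hPL := (hmem P).2 hPR
    have h := NLSWeyl.bracket_same_side hL
      (fun _ _ => NLSWeyl.isWeylSolution_iff_of_mem_GammaL hQL)
      (fun _ _ => NLSWeyl.isWeylSolution_iff_of_mem_GammaL hPL) hQ hP
    refine ⟨h.1, fun hQ' => absurd hQ' hQR, fun _ _ hne => ?_, fun hQ' => absurd hQ' hQR⟩
    rw [h.2 fun hlam => hne (NLSWeyl.SpectralPoint.eq_of_lam_eq (iff_of_false hQR hPR) hlam)]
    norm_num
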